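/- **Corollary 7.9.** Let $\Sigma$ be a simplicial complex of dimension $d\ge 0$ on the vertex set $[n]=\{1,\dots,n\}$, that is, a family of subsets of $[n]$ (called faces) that contains $\emptyset$ and is closed under taking subsets, whose largest members have $d+1$ elements. Suppose that $\Sigma$ is *shifted*: whenever $i<j$ in $[n]$ and $F\in\Sigma$ with $i\notin F$, $j\in F$, then $(F\setminus\{j\})\cup\{i\}\in\Sigma$. Write $\Sigma_i$ for the set of faces of $\Sigma$ with $i+1$ elements, and $\deg_{\Sigma_d}(v)=|\{F\in\Sigma_d : v\in F\}|$ (so $\deg_{\Sigma_d}(n+1)=0$). Let $\Bbbk$ be the field of rational functions in indeterminates $x_1,x_2,\dots$ over a field $k$ of characteristic zero; put $X_j=x_j^2$, $E_t=X_1+\dots+X_t$, and $x_F=\prod_{v\in F}x_v$ for finite $F$. In the *coarse weighting*, the top boundary map sends a face $F\in\Sigma_d$ to $$\partial[F]=\sum_{j\in F}\varepsilon(j,F)\,\frac{x_F}{x_{F\setminus\{j\}}}\,[F\setminus\{j\}],$$ where $\varepsilon(j,F)=(-1)^{r+1}$ if $j$ is the $r$-th smallest element of $F$. Let $L=\partial\,\partial^{\mathsf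 T}$ be the coarsely weighted up-down Laplacian, a square matrix over $\Bbbk$ with rows and columns indexed by $\Sigma_{d-1}$. Then: 1. $\deg_{\Sigma_d}(1)\ge\deg_{\Sigma_d}(2)\ge\dots\ge\deg_{\Sigma_d}(n)$, so that the degree sequence is a partition (up to zero entries); its conjugate is the partition in which each $t\in[n]$ occurs with multiplicity $\deg_{\Sigma_d}(t)-\deg_{\Sigma_d}(t+1)$. 2. The characteristic polynomial of $L$ splits into linear factors over $\Bbbk$, and the multiset of the nonzero eigenvalues of $L$ (counted as roots of the characteristic polynomial) is the multiset of the linear forms $E_t$, where $t$ ranges over the parts of this conjugate partition, with multiplicity. 3. (Duval–Reiner) With all weights equal to $1$, the characteristic polynomial of the unweighted up-down Laplacian splits over $k$, and the multiset of its nonzero eigenvalues is the multiset of parts $t$ of this conjugate partition. -/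

import Mathlib

namespace ShiftedLaplacian

open Finset

/-- A simplicial complex on a finite vertex set `V` of natural numbers: a family of subsets of `V`
that contains the empty set and is closed under taking subsets. (An element of `V` need not be a
face by itself.) -/
structure Complex (V : Finset ℕ) where
  faces : Finset (Finset ℕ)
  subset_vertices : ∀ F ∈ faces, F ⊆ V
  empty_mem : ∅ ∈ faces
  down_closed : ∀ F ∈ faces, ∀ G, G ⊆ F → G ∈ faces

namespace Complex

variable {V : Finset ℕ}

/-- The faces with exactly `m` elements, i.e. the faces of dimension `m - 1`. -/
def facesOfCard (S : Complex V) (m : ℕ) : Finset (Finset ℕ) :=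
  S.faces.filter fun F => F.card = m

/-- The complex has dimension `d`: the largest faces have `d + 1` elements. -/
def HasDim (S : Complex V) (d : ℕ) : Prop :=
  (∀ F ∈ S.faces, F.card ≤ d + 1) ∧ ∃ F ∈ S.faces, F.card = d + 1

/-- The complex is shifted: replacing a vertex of a face by a smaller vertex that is not in the
face gives a face again. -/
def IsShifted (S : Complex V) : Prop :=
  ∀ i ∈ V, ∀ j ∈ V, i < j → ∀ F ∈ S.faces, i ∉ F → j ∈ F → insert i (F.erase j) ∈ S.faces

/-- The degree of the vertex `v` in the family of all `d`-dimensional faces. -/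
def deg (S : Complex V) (d v : ℕ) : ℕ :=
  ((S.facesOfCard (d + 1)).filter fun F => v ∈ F).card

end Complex

/-- The position of `v` in `F`: it is `j` if `v` is the `j`-th smallest element of `F`. -/
def position (v : ℕ) (F : Finset ℕ) : ℕ := (F.filter fun u => u ≤ v).card

/-- The incidence sign: `(-1)^(j+1)` if `v` is the `j`-th smallest element of `F`,
and `0` if `v ∉ F`. -/
def eps (R : Type*) [Ring R] (v : ℕ) (F : Finset ℕ) : R :=
  if v ∈ F then (-1) ^ (position v F + 1) else 0

section Weighted

variable {K : Type*} [Field K] {V : Finset ℕ}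

/-- For weights `x i j` and `F = {v₁ < ⋯ < vₘ}`, the monomial `x_{1,v₁} ⋯ x_{m,vₘ}` raised `a`
times, that is `x_{1+a,v₁} ⋯ x_{m+a,vₘ}`. -/
def raisedMonomial (x : ℕ → ℕ → K) (a : ℕ) (F : Finset ℕ) : K :=
  ∏ v ∈ F, x (position v F + a) v

/-- The matrix of the algebraic weighted boundary map from `i`-chains to `(i-1)`-chains of a
complex of dimension `d` (for `i ≤ d`). The column of `F` holds the coefficients of
`∑_{j ∈ F} ε(j,F) * (↑^{d-i} x_F) / (↑^{d-i+1} x_{F∖j}) • [F∖j]`. -/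
def boundary (x : ℕ → ℕ → K) (S : Complex V) (d i : ℕ) :
    Matrix (S.facesOfCard i) (S.facesOfCard (i + 1)) K :=
  Matrix.of fun G F => ∑ j ∈ F.1, if F.1.erase j = G.1 then
    eps K j F.1 * (raisedMonomial x (d - i) F.1 / raisedMonomial x (d - i + 1) (F.1.erase j))
    else 0

/-- The weighted up-down Laplacian on `(i-1)`-chains: the boundary map from `i`-chains after its
transpose, the coboundary map. -/
def upDownLaplacian (x : ℕ → ℕ → K) (S : Complex V) (d i : ℕ) :
    Matrix (S.facesOfCard i) (S.facesOfCard i) K :=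
  boundary x S d i * (boundary x S d i).transpose

/-- The unweighted up-down Laplacian on `(i-1)`-chains: all weights are `1`. -/
def unweightedLaplacian (K : Type*) [Field K] (S : Complex V) (d i : ℕ) :
    Matrix (S.facesOfCard i) (S.facesOfCard i) K :=
  upDownLaplacian (fun _ _ => (1 : K)) S d i

end Weighted

/-- The field of rational functions over `k` in indeterminates `x_j`, `j ∈ ℕ`. -/
abbrev CoarseField (k : Type*) [Field k] : Type _ := FractionRing (MvPolynomial ℕ k)

/-- The indeterminate `x_j`. -/
noncomputable def coarseVar (k : Type*) [Field k] (j : ℕ) : CoarseField k :=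
  algebraMap (MvPolynomial ℕ k) (CoarseField k) (MvPolynomial.X j)

/-- The up-down Laplacian on `(i-1)`-chains in the coarse weighting `x_{i,j} = x_j`. -/
noncomputable def coarseLaplacian (k : Type*) [Field k] {V : Finset ℕ} (S : Complex V) (d i : ℕ) :
    Matrix (S.facesOfCard i) (S.facesOfCard i) (CoarseField k) :=
  upDownLaplacian (fun _ j => coarseVar k j) S d i

/-- The linear form `E_t = X_1 + ⋯ + X_t`, where `X_j = x_j ^ 2`. -/
noncomputable def linearForm (k : Type*) [Field k] (t : ℕ) : CoarseField k :=
  ∑ j ∈ Icc 1 t, coarseVar k j ^ 2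

/-- The conjugate of a partition `lam 1 ≥ lam 2 ≥ ⋯ ≥ lam n`, where `lam (n + 1) = 0`, as a multiset
of parts: each `t` in `[n]` occurs with multiplicity `lam t - lam (t + 1)`. -/
def conjugateParts (n : ℕ) (lam : ℕ → ℕ) : Multiset ℕ :=
  ∑ t ∈ Icc 1 n, Multiset.replicate (lam t - lam (t + 1)) t

open scoped Classical in
/-- The multiset of all eigenvalues of the square matrix `L` over `K` is `A`, up to the
multiplicity of zero: the characteristic polynomial splits over `K` (so there are no other
eigenvalues in an extension field), and its roots are the elements of `A`, with the same
multiplicities except possibly for zero. -/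
def HasEigenvaluesUpToZero {K ι : Type*} [Field K] [Fintype ι] [DecidableEq ι]
    (L : Matrix ι ι K) (A : Multiset K) : Prop :=
  L.charpoly.Splits ∧ L.charpoly.roots.filter (· ≠ 0) = A.filter (· ≠ 0)

end ShiftedLaplacian

/-! Up to zeros, `∂∂ᵀ` and `∂ᵀ∂` have the same eigenvalues, so it suffices to treat the down-up
Laplacian `∂ᵀ∂`. It depends only on the family of top faces, which allows induction on the number of
vertices.

Split a shifted family on `{m, …, n}` at its least vertex into the cone over the link `L` and the
deletion `B`. Shiftedness puts the shadow of `B` inside `L`, so the boundary of `B` is a matrix `P`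
with rows in `L`. With `N` the down-up Laplacian of `L`, that of the whole family has blocks `x_m² +
N`, `x_m P`, `x_m Pᵀ`, `PᵀP`. As `∂∂ = 0` gives `PᵀN = 0`, this matrix factors as `J J'` with `J' J
= x_m² + (PPᵀ + N)`.

Since `PPᵀ N = 0`, the nonzero eigenvalues of `PPᵀ + N` are those of `B` together with those of `L`,
known by induction. Adding `x_m²` turns `X_{m+1} + ⋯ + X_t` into `X_m + ⋯ + X_t` and the leftover
zeros into `X_m`. Degrees add over link and deletion, hence so do the multiplicities
(`charpoly_downUpMatrix`). -/

namespace ShiftedLaplacian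

open Finset Polynomial

/-! ### Characteristic polynomials of sums and block matrices -/

section MatrixLemmas

variable {K α β γ : Type*} [Field K] [Fintype α] [DecidableEq α] [Fintype β] [DecidableEq β]
  [Fintype γ]

/-- If `U * V = 0`, the characteristic polynomial of `U + V` is, up to a power of `X`, the product
of the characteristic polynomials of `U` and `V`. -/
theorem charpoly_add_mul_X_pow_of_mul_eq_zero (U V : Matrix α α K) (h : U * V = 0) :
    (U + V).charpoly * X ^ Fintype.card α = U.charpoly * V.charpoly := by
  -- `(X - U)(X - V) = X² - XU - XV`, because the term `UV` vanishes.
  have key : (X : K[X]) • (U + V).charmatrix = U.charmatrix * V.charmatrix := by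
    have h' : U.map C * V.map C = (0 : Matrix α α K[X]) := by
      rw [← Matrix.map_mul, h]; simp
    have hs : ∀ M : Matrix α α K[X], X • M = Matrix.scalar α X * M := fun M => by
      rw [Matrix.scalar_apply, Matrix.smul_eq_diagonal_mul]
    have hc : U.map C * Matrix.scalar α X = Matrix.scalar α X * U.map C :=
      (Matrix.scalar_commute (X : K[X]) (fun r => Commute.all _ _) (U.map C)).eq.symm
    simp only [Matrix.charmatrix, RingHom.mapMatrix_apply, sub_mul, mul_sub, h', hs, hc,
      Matrix.map_add C (fun a b => C_add), mul_add]
    abel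
  have := congrArg Matrix.det key
  rw [Matrix.det_smul, Matrix.det_mul] at this
  rw [Matrix.charpoly, Matrix.charpoly, Matrix.charpoly, ← this, mul_comm]

/-- Adding the scalar matrix `c` shifts the characteristic polynomial by `c`. -/
theorem charpoly_scalar_add (c : K) (U : Matrix α α K) :
    (Matrix.scalar α c + U).charpoly = U.charpoly.comp (X - C c) := by
  rw [add_comm, sub_eq_add_neg, ← C_neg, ← Matrix.charpoly_sub_scalar, map_neg, sub_neg_eq_add]

/-- The characteristic polynomial of the Gram matrix of the block matrix with rows `(y, P)` and
`(-Q, 0)`, where `y` is a nonzero scalar. -/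
theorem charpoly_fromBlocks_cone (y : K) (hy : y ≠ 0) (P : Matrix α β K) (N : Matrix α α K)
    (hN : P.transpose * N = 0) :
    X ^ Fintype.card α * (Matrix.fromBlocks (Matrix.scalar α (y ^ 2) + N) (y • P)
      (y • P.transpose) (P.transpose * P)).charpoly =
    X ^ (Fintype.card α + Fintype.card β) *
      (Matrix.scalar α (y ^ 2) + (P * P.transpose + N)).charpoly := by
  -- The summand `y⁻¹ N` yields `N` in the corner of `J J'` and is killed by `Pᵀ` in the lower row.
  let J : Matrix (α ⊕ β) α K := Matrix.fromRows (Matrix.scalar α y) P.transpose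
  let J' : Matrix α (α ⊕ β) K := Matrix.fromCols (Matrix.scalar α y + y⁻¹ • N) P
  have h1 : Matrix.fromBlocks (Matrix.scalar α (y ^ 2) + N) (y • P)
      (y • P.transpose) (P.transpose * P) = J * J' := by
    have e : Matrix.scalar α y * (Matrix.scalar α y + y⁻¹ • N) =
        Matrix.scalar α (y ^ 2) + N := by
      rw [mul_add, ← map_mul, ← sq, Matrix.scalar_apply, Matrix.scalar_apply,
        ← Matrix.smul_eq_diagonal_mul, smul_smul, mul_inv_cancel₀ hy, one_smul]
    rw [Matrix.fromRows_mul_fromCols, e, Matrix.mul_add, Matrix.mul_smul, hN, smul_zero, add_zero,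
      Matrix.scalar_apply y, ← Matrix.smul_eq_diagonal_mul, ← Matrix.smul_eq_mul_diagonal]
  have h2 : J' * J = Matrix.scalar α (y ^ 2) + (P * P.transpose + N) := by
    rw [Matrix.fromCols_mul_fromRows, add_mul, ← map_mul, ← sq, Matrix.scalar_apply,
      Matrix.scalar_apply, ← Matrix.smul_eq_mul_diagonal, smul_smul, mul_inv_cancel₀ hy,
      one_smul, add_assoc, add_comm N]
  rw [h1, ← h2, ← Fintype.card_sum]
  exact Matrix.charpoly_mul_comm' J J'

end MatrixLemmas

/-! ### The boundary map and `∂∂ = 0` -/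

section Boundary

variable {K : Type*} [Field K]

/-- The coefficient of `[G]` in the boundary `∑_{j ∈ F} ε(j,F) x_j [F∖j]` of `[F]`. -/
def boundaryCoeff (x : ℕ → K) (G F : Finset ℕ) : K :=
  ∑ j ∈ F, if F.erase j = G then eps K j F * x j else 0

/-- The boundary matrix with rows indexed by `𝒢` and columns indexed by `𝒜`. -/
def boundaryMatrix (x : ℕ → K) (𝒢 𝒜 : Finset (Finset ℕ)) : Matrix 𝒢 𝒜 K :=
  Matrix.of fun G F => boundaryCoeff x G.1 F.1

/-- The down-up Laplacian of a family of finite sets. -/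
def downUpMatrix (x : ℕ → K) (𝒜 : Finset (Finset ℕ)) : Matrix 𝒜 𝒜 K :=
  Matrix.of fun F F' => ∑ G ∈ 𝒜.shadow, boundaryCoeff x G F.1 * boundaryCoeff x G F'.1

theorem boundaryCoeff_eq_zero (x : ℕ → K) {G F : Finset ℕ} (h : ∀ j ∈ F, F.erase j ≠ G) :
    boundaryCoeff x G F = 0 :=
  Finset.sum_eq_zero fun j hj => if_neg (h j hj)

theorem boundaryCoeff_eq_zero_of_notMem_shadow (x : ℕ → K) {𝒜 : Finset (Finset ℕ)}
    {G F : Finset ℕ} (hF : F ∈ 𝒜) (h : G ∉ 𝒜.shadow) : boundaryCoeff x G F = 0 :=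
  boundaryCoeff_eq_zero x fun _ hj he => h (he ▸ erase_mem_shadow hF hj)

theorem sum_boundaryCoeff_mul (x : ℕ → K) {𝒢 : Finset (Finset ℕ)} {F : Finset ℕ}
    (h : ∀ j ∈ F, F.erase j ∈ 𝒢) (f : Finset ℕ → K) :
    ∑ G ∈ 𝒢, f G * boundaryCoeff x G F = ∑ j ∈ F, f (F.erase j) * (eps K j F * x j) := by
  simp only [boundaryCoeff, Finset.mul_sum]
  rw [Finset.sum_comm]
  refine Finset.sum_congr rfl fun j hj => ?_
  rw [Finset.sum_eq_single (F.erase j)]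
  · simp
  · intro G _ hG; simp [hG.symm]
  · intro h'; exact absurd (h j hj) h'

theorem position_erase_of_lt {F : Finset ℕ} {i j : ℕ} (h : i < j) :
    position i (F.erase j) = position i F := by
  unfold position
  congr 1
  ext u
  simp only [mem_filter, mem_erase]
  constructor
  · rintro ⟨⟨_, h1⟩, h2⟩; exact ⟨h1, h2⟩
  · rintro ⟨h1, h2⟩; exact ⟨⟨by omega, h1⟩, h2⟩

theorem position_erase_of_gt {F : Finset ℕ} {i j : ℕ} (hi : i ∈ F) (h : i < j) :
    position j (F.erase i) + 1 = position j F := by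
  unfold position
  rw [Finset.filter_erase, Finset.card_erase_add_one]
  simp [hi, h.le]

/-- Removing `i` lowers the position of `j` by one, while removing `j` leaves that of `i` unchanged.
-/
theorem eps_mul_eps_erase_of_lt {F : Finset ℕ} {i j : ℕ} (hi : i ∈ F) (hj : j ∈ F) (h : i < j) :
    eps K i (F.erase j) * eps K j F = -(eps K j (F.erase i) * eps K i F) := by
  have h1 : i ∈ F.erase j := mem_erase.2 ⟨h.ne, hi⟩
  have h2 : j ∈ F.erase i := mem_erase.2 ⟨h.ne', hj⟩
  simp only [eps, if_pos h1, if_pos h2, if_pos hi, if_pos hj, position_erase_of_lt h,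
    ← position_erase_of_gt hi h]
  ring

theorem eps_mul_eps_erase {F : Finset ℕ} {i j : ℕ} (hi : i ∈ F) (hj : j ∈ F) (h : i ≠ j) :
    eps K i (F.erase j) * eps K j F = -(eps K j (F.erase i) * eps K i F) := by
  rcases lt_or_gt_of_ne h with h | h
  · exact eps_mul_eps_erase_of_lt hi hj h
  · rw [eps_mul_eps_erase_of_lt hj hi h, neg_neg]

/-- The boundary of a boundary is zero. -/
theorem sum_boundaryCoeff_mul_boundaryCoeff (x : ℕ → K) {𝒢 : Finset (Finset ℕ)}
    {H F : Finset ℕ} (h : ∀ j ∈ F, F.erase j ∈ 𝒢) :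
    ∑ G ∈ 𝒢, boundaryCoeff x H G * boundaryCoeff x G F = 0 := by
  rw [sum_boundaryCoeff_mul x h]
  simp only [boundaryCoeff, Finset.sum_mul]
  rw [Finset.sum_sigma']
  -- The two orders of removing `i` and `j` cancel.
  refine Finset.sum_involution (fun p _ => ⟨p.2, p.1⟩) ?_ ?_ ?_ ?_
  · rintro ⟨j, i⟩ hp
    simp only [mem_sigma, mem_erase] at hp
    obtain ⟨hj, hij, hi⟩ := hp
    simp only [Finset.erase_right_comm (a := i) (b := j)]
    split_ifs
    · linear_combination x i * x j * eps_mul_eps_erase (K := K) hi hj hij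
    · simp
  · rintro ⟨j, i⟩ hp _ he
    simp only [mem_sigma, mem_erase] at hp
    exact hp.2.1 (congrArg Sigma.fst he)
  · rintro ⟨j, i⟩ hp
    simp only [mem_sigma, mem_erase] at hp ⊢
    exact ⟨hp.2.2, hp.2.1.symm, hp.1⟩
  · rintro ⟨j, i⟩ _; rfl

/-- Rows outside the shadow are zero, so the Gram matrix does not depend on the choice of rows. In
the induction the rows for the deletion can therefore be the link. -/
theorem boundaryMatrix_transpose_mul_self (x : ℕ → K) {𝒢 𝒜 : Finset (Finset ℕ)}
    (h : 𝒜.shadow ⊆ 𝒢) :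
    (boundaryMatrix x 𝒢 𝒜).transpose * boundaryMatrix x 𝒢 𝒜 = downUpMatrix x 𝒜 := by
  ext F F'
  simp only [Matrix.mul_apply, Matrix.transpose_apply, boundaryMatrix, downUpMatrix,
    Matrix.of_apply]
  rw [Finset.sum_coe_sort 𝒢 (fun G => boundaryCoeff x G F.1 * boundaryCoeff x G F'.1)]
  refine (Finset.sum_subset h fun G _ hG => ?_).symm
  rw [boundaryCoeff_eq_zero_of_notMem_shadow x F.2 hG, zero_mul]

theorem boundaryMatrix_mul_boundaryMatrix (x : ℕ → K) {ℋ 𝒢 𝒜 : Finset (Finset ℕ)}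
    (h : 𝒜.shadow ⊆ 𝒢) : boundaryMatrix x ℋ 𝒢 * boundaryMatrix x 𝒢 𝒜 = 0 := by
  ext H F
  simp only [Matrix.mul_apply, boundaryMatrix, Matrix.of_apply, Matrix.zero_apply]
  rw [Finset.sum_coe_sort 𝒢 (fun G => boundaryCoeff x H.1 G * boundaryCoeff x G F.1)]
  exact sum_boundaryCoeff_mul_boundaryCoeff x fun j hj => h (erase_mem_shadow F.2 hj)

end Boundary

/-! ### Link and deletion at the least vertex -/

section Cone

variable {K : Type*} [Field K]

theorem eps_insert_self {m : ℕ} {F : Finset ℕ} (hF : ∀ v ∈ F, m < v) :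
    eps K m (insert m F) = 1 := by
  have : position m (insert m F) = 1 := by
    rw [position, Finset.card_eq_one]
    refine ⟨m, ?_⟩
    ext u
    simp only [mem_filter, mem_insert, mem_singleton]
    constructor
    · rintro ⟨rfl | h, h'⟩
      · rfl
      · have := hF u h; omega
    · rintro rfl; simp
  simp [eps, this]

/-- The new least element moves every position up by one. -/
theorem eps_insert_of_mem {m j : ℕ} {F : Finset ℕ} (hF : ∀ v ∈ F, m < v) (hj : j ∈ F) :
    eps K j (insert m F) = -eps K j F := by
  have hm : m ∉ F := fun h => lt_irrefl _ (hF m h)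
  have := position_erase_of_gt (mem_insert_self m F) (hF j hj)
  rw [erase_insert hm] at this
  rw [eps, eps, if_pos hj, if_pos (mem_insert_of_mem hj), ← this]
  ring

theorem boundaryCoeff_insert (x : ℕ → K) {m : ℕ} {G F : Finset ℕ} (hF : ∀ v ∈ F, m < v)
    (hG : m ∉ G) : boundaryCoeff x G (insert m F) = if F = G then x m else 0 := by
  have hm : m ∉ F := fun h => lt_irrefl _ (hF m h)
  rw [boundaryCoeff, Finset.sum_insert hm, erase_insert hm, eps_insert_self hF, one_mul,
    Finset.sum_eq_zero, add_zero]
  intro j hj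
  refine if_neg fun he => hG ?_
  rw [← he]
  exact mem_erase.2 ⟨(hF j hj).ne, mem_insert_self _ _⟩

theorem boundaryCoeff_insert_insert (x : ℕ → K) {m : ℕ} {G F : Finset ℕ} (hF : ∀ v ∈ F, m < v)
    (hG : m ∉ G) : boundaryCoeff x (insert m G) (insert m F) = -boundaryCoeff x G F := by
  have hm : m ∉ F := fun h => lt_irrefl _ (hF m h)
  rw [boundaryCoeff, Finset.sum_insert hm, erase_insert hm, if_neg, zero_add, boundaryCoeff,
    ← Finset.sum_neg_distrib]
  · refine Finset.sum_congr rfl fun j hj => ?_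
    rw [Finset.erase_insert_of_ne (hF j hj).ne, eps_insert_of_mem hF hj]
    have : (insert m (F.erase j) = insert m G) ↔ F.erase j = G := by
      constructor
      · intro h
        have := congrArg (fun s => Finset.erase s m) h
        simpa [erase_insert hG, erase_insert (show m ∉ F.erase j from
          fun h => hm (mem_of_mem_erase h))] using this
      · intro h; rw [h]
    simp only [this]
    split_ifs <;> ring
  · intro h; exact hm (h ▸ mem_insert_self _ _)

theorem boundaryCoeff_insert_left (x : ℕ → K) {m : ℕ} {G F : Finset ℕ} (hF : m ∉ F) :
    boundaryCoeff x (insert m G) F = 0 :=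
  boundaryCoeff_eq_zero x fun _ _ he =>
    hF (mem_of_mem_erase (he ▸ mem_insert_self m G))

/-- The members of `𝒜` that contain `m`, with `m` removed. -/
def link (𝒜 : Finset (Finset ℕ)) (m : ℕ) : Finset (Finset ℕ) :=
  (𝒜.filter (m ∈ ·)).image (·.erase m)

/-- The members of `𝒜` that do not contain `m`. -/
def deletion (𝒜 : Finset (Finset ℕ)) (m : ℕ) : Finset (Finset ℕ) :=
  𝒜.filter (m ∉ ·)

theorem mem_link {𝒜 : Finset (Finset ℕ)} {m : ℕ} {F : Finset ℕ} :
    F ∈ link 𝒜 m ↔ m ∉ F ∧ insert m F ∈ 𝒜 := by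
  simp only [link, mem_image, mem_filter]
  constructor
  · rintro ⟨G, ⟨hG, hm⟩, rfl⟩
    exact ⟨notMem_erase _ _, by rwa [insert_erase hm]⟩
  · rintro ⟨hm, h⟩
    exact ⟨_, ⟨h, mem_insert_self _ _⟩, erase_insert hm⟩

theorem mem_deletion {𝒜 : Finset (Finset ℕ)} {m : ℕ} {F : Finset ℕ} :
    F ∈ deletion 𝒜 m ↔ F ∈ 𝒜 ∧ m ∉ F := mem_filter

/-- A family is the disjoint union of the cone over its link and of its deletion. -/
def linkSumDeletionEquiv (𝒜 : Finset (Finset ℕ)) (m : ℕ) : link 𝒜 m ⊕ deletion 𝒜 m ≃ 𝒜 where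
  toFun := Sum.elim (fun F => ⟨insert m F.1, (mem_link.1 F.2).2⟩)
    (fun F => ⟨F.1, (mem_deletion.1 F.2).1⟩)
  invFun F := if h : m ∈ F.1 then
      Sum.inl ⟨F.1.erase m, mem_link.2 ⟨notMem_erase _ _, by rw [insert_erase h]; exact F.2⟩⟩
    else Sum.inr ⟨F.1, mem_deletion.2 ⟨F.2, h⟩⟩
  left_inv := by
    rintro (⟨F, hF⟩ | ⟨F, hF⟩)
    · simp [erase_insert (mem_link.1 hF).1]
    · simp [(mem_deletion.1 hF).2]
  right_inv := by
    rintro ⟨F, hF⟩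
    by_cases h : m ∈ F <;> simp [h]

/-- The down-up Laplacian of a family in terms of its link and its deletion at the least
vertex. -/
theorem downUpMatrix_submatrix_linkSumDeletion (x : ℕ → K) {𝒜 : Finset (Finset ℕ)} {m : ℕ}
    (hm : ∀ F ∈ 𝒜, ∀ v ∈ F, m ≤ v) (hsh : (deletion 𝒜 m).shadow ⊆ link 𝒜 m) :
    (downUpMatrix x 𝒜).submatrix (linkSumDeletionEquiv 𝒜 m) (linkSumDeletionEquiv 𝒜 m) =
    Matrix.fromBlocks (Matrix.scalar _ (x m ^ 2) + downUpMatrix x (link 𝒜 m))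
      (x m • boundaryMatrix x (link 𝒜 m) (deletion 𝒜 m))
      (x m • (boundaryMatrix x (link 𝒜 m) (deletion 𝒜 m)).transpose)
      ((boundaryMatrix x (link 𝒜 m) (deletion 𝒜 m)).transpose *
        boundaryMatrix x (link 𝒜 m) (deletion 𝒜 m)) := by
  have hlink : ∀ F ∈ link 𝒜 m, ∀ v ∈ F, m < v := fun F hF v hv =>
    lt_of_le_of_ne (hm _ (mem_link.1 hF).2 v (mem_insert_of_mem hv))
      fun h => (mem_link.1 hF).1 (h ▸ hv)
  have hls : ∀ G ∈ (link 𝒜 m).shadow, m ∉ G := fun G hG h => by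
    obtain ⟨F, hF, j, _, rfl⟩ := mem_shadow_iff.1 hG
    exact (mem_link.1 hF).1 (mem_of_mem_erase h)
  -- Rows without `m` lie in the link, for faces avoiding `m` by `hsh`; rows with `m` are cones over
  -- the shadow of the link.
  let 𝒢 : Finset (Finset ℕ) := link 𝒜 m ∪ (link 𝒜 m).shadow.image (insert m)
  have hsub : 𝒜.shadow ⊆ 𝒢 := by
    intro G hG
    obtain ⟨F, hF, j, hj, rfl⟩ := mem_shadow_iff.1 hG
    by_cases hmF : m ∈ F
    · have hL : F.erase m ∈ link 𝒜 m :=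
        mem_link.2 ⟨notMem_erase _ _, by rwa [insert_erase hmF]⟩
      by_cases hjm : j = m
      · subst hjm; exact mem_union_left _ hL
      · refine mem_union_right _ (mem_image.2 ⟨(F.erase m).erase j,
          erase_mem_shadow hL (mem_erase.2 ⟨hjm, hj⟩), ?_⟩)
        rw [erase_right_comm, insert_erase (mem_erase.2 ⟨Ne.symm hjm, hmF⟩)]
    · exact mem_union_left _ (hsh (erase_mem_shadow (mem_deletion.2 ⟨hF, hmF⟩) hj))
  have hD : ∀ F F' : 𝒜, downUpMatrix x 𝒜 F F' =
      ∑ G ∈ link 𝒜 m, boundaryCoeff x G F.1 * boundaryCoeff x G F'.1 +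
      ∑ G ∈ (link 𝒜 m).shadow,
        boundaryCoeff x (insert m G) F.1 * boundaryCoeff x (insert m G) F'.1 := by
    intro F F'
    rw [downUpMatrix, Matrix.of_apply, Finset.sum_subset hsub, Finset.sum_union,
      Finset.sum_image]
    · intro G hG G' hG' h
      have := congrArg (fun s => Finset.erase s m) h
      simpa [erase_insert (hls G hG), erase_insert (hls G' hG')] using this
    · rw [Finset.disjoint_left]
      intro G hG hG'
      obtain ⟨H, _, rfl⟩ := mem_image.1 hG'
      exact (mem_link.1 hG).1 (mem_insert_self _ _)
    · intro G _ hG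
      rw [boundaryCoeff_eq_zero_of_notMem_shadow x F.2 hG, zero_mul]
  -- Among the rows without `m`, the column of the cone over `F` has a single nonzero candidate,
  -- namely `F` itself.
  have hins : ∀ F : link 𝒜 m, ∀ f : Finset ℕ → K,
      ∑ G ∈ link 𝒜 m, boundaryCoeff x G (insert m F.1) * f G = x m * f F.1 := by
    intro F f
    rw [Finset.sum_eq_single F.1]
    · rw [boundaryCoeff_insert x (hlink _ F.2) (mem_link.1 F.2).1, if_pos rfl]
    · intro G hG hne
      rw [boundaryCoeff_insert x (hlink _ F.2) (mem_link.1 hG).1, if_neg hne.symm, zero_mul]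
    · intro h; exact absurd F.2 h
  have hdel : ∀ F : deletion 𝒜 m, m ∉ F.1 := fun F => (mem_deletion.1 F.2).2
  ext (F | F) (F' | F')
  · simp only [Matrix.submatrix_apply, hD, linkSumDeletionEquiv, Equiv.coe_fn_mk, Sum.elim_inl,
      Matrix.fromBlocks_apply₁₁, Matrix.add_apply, hins,
      boundaryCoeff_insert x (hlink _ F'.2) (mem_link.1 F.2).1]
    congr 1
    · simp only [Matrix.scalar_apply, Matrix.diagonal_apply, Subtype.ext_iff, eq_comm (a := F'.1)]
      split_ifs <;> ring
    · rw [downUpMatrix, Matrix.of_apply]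
      refine Finset.sum_congr rfl fun G hG => ?_
      rw [boundaryCoeff_insert_insert x (hlink _ F.2) (hls G hG),
        boundaryCoeff_insert_insert x (hlink _ F'.2) (hls G hG), neg_mul_neg]
  · simp only [Matrix.submatrix_apply, hD, linkSumDeletionEquiv, Equiv.coe_fn_mk, Sum.elim_inl,
      Sum.elim_inr, Matrix.fromBlocks_apply₁₂, hins, boundaryCoeff_insert_left x (hdel F')]
    simp [boundaryMatrix]
  · simp only [Matrix.submatrix_apply, hD, linkSumDeletionEquiv, Equiv.coe_fn_mk, Sum.elim_inl,
      Sum.elim_inr, Matrix.fromBlocks_apply₂₁, boundaryCoeff_insert_left x (hdel F)]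
    simp only [mul_comm (boundaryCoeff x _ F.1), hins]
    simp [boundaryMatrix]
  · simp only [Matrix.submatrix_apply, hD, linkSumDeletionEquiv, Equiv.coe_fn_mk,
      Sum.elim_inr, Matrix.fromBlocks_apply₂₂, boundaryCoeff_insert_left x (hdel F)]
    simp only [Matrix.mul_apply, Matrix.transpose_apply, boundaryMatrix, Matrix.of_apply]
    rw [Finset.sum_coe_sort (link 𝒜 m)
      (fun G => boundaryCoeff x G F.1 * boundaryCoeff x G F'.1)]
    simp

end Cone

/-! ### Shifted families and the induction on vertices -/

section Shifted

/-- The number of members of `𝒜` that contain `v`. -/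
def familyDeg (𝒜 : Finset (Finset ℕ)) (v : ℕ) : ℕ := (𝒜.filter (v ∈ ·)).card

/-- A family of subsets of `{m, …, n}` is shifted if replacing an element of a member by a
smaller one that is not in the member gives a member again. -/
structure IsShiftedFamily (m n : ℕ) (𝒜 : Finset (Finset ℕ)) : Prop where
  subset_Icc : ∀ F ∈ 𝒜, F ⊆ Icc m n
  insert_erase_mem : ∀ i ∈ Icc m n, ∀ j ∈ Icc m n, i < j → ∀ F ∈ 𝒜, i ∉ F → j ∈ F →
    insert i (F.erase j) ∈ 𝒜

namespace IsShiftedFamily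

variable {m n : ℕ} {𝒜 : Finset (Finset ℕ)}

/-- Swapping `w` for `v` in the members that lack `v` is injective: the image contains `w` exactly
when nothing was swapped. -/
theorem familyDeg_antitone (h : IsShiftedFamily m n 𝒜) {v w : ℕ} (hv : m ≤ v) (hvw : v ≤ w) :
    familyDeg 𝒜 w ≤ familyDeg 𝒜 v := by
  rcases hvw.eq_or_lt with rfl | hlt
  · rfl
  have hIcc : ∀ F ∈ 𝒜, w ∈ F → v ∈ Icc m n ∧ w ∈ Icc m n := fun F hF hw => by
    have := h.subset_Icc F hF hw
    simp only [mem_Icc] at this ⊢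
    omega
  refine Finset.card_le_card_of_injOn (fun F => if v ∈ F then F else insert v (F.erase w)) ?_ ?_
  · intro F hF
    simp only [coe_filter, Set.mem_ofPred_eq] at hF ⊢
    split_ifs with hvF
    · exact ⟨hF.1, hvF⟩
    · exact ⟨h.insert_erase_mem v (hIcc F hF.1 hF.2).1 w (hIcc F hF.1 hF.2).2 hlt F hF.1 hvF hF.2,
        mem_insert_self _ _⟩
  · intro F hF G hG he
    simp only [coe_filter, Set.mem_ofPred_eq] at hF hG
    have hw : ∀ H : Finset ℕ, w ∉ insert v (H.erase w) := fun H => by simp [hlt.ne']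
    by_cases hvF : v ∈ F <;> by_cases hvG : v ∈ G <;> simp only [hvF, hvG, if_true, if_false] at he
    · exact he
    · exact absurd (he ▸ hF.2) (hw G)
    · exact absurd (he ▸ hG.2) (hw F)
    · have h' := congrArg (fun s => insert w (Finset.erase s v)) he
      simpa [erase_insert (show v ∉ F.erase w from fun h => hvF (mem_of_mem_erase h)),
        erase_insert (show v ∉ G.erase w from fun h => hvG (mem_of_mem_erase h)),
        insert_erase hF.2, insert_erase hG.2] using h'

theorem link (h : IsShiftedFamily m n 𝒜) : IsShiftedFamily (m + 1) n (link 𝒜 m) where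
  subset_Icc F hF v hv := by
    have h1 := h.subset_Icc _ (mem_link.1 hF).2 (mem_insert_of_mem hv)
    have h2 : v ≠ m := fun e => (mem_link.1 hF).1 (e ▸ hv)
    simp only [mem_Icc] at h1 ⊢
    omega
  insert_erase_mem i hi j hj hij F hF hiF hjF := by
    simp only [mem_Icc] at hi hj
    obtain ⟨hm, hF⟩ := mem_link.1 hF
    refine mem_link.2 ⟨?_, ?_⟩
    · simp only [mem_insert, mem_erase, not_or, not_and]
      exact ⟨by omega, fun _ => hm⟩
    · have := h.insert_erase_mem i (mem_Icc.2 (by omega)) j (mem_Icc.2 (by omega)) hij _ hF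
        (by simp only [mem_insert, not_or]; exact ⟨by omega, hiF⟩) (mem_insert_of_mem hjF)
      rwa [erase_insert_of_ne (by omega), insert_comm] at this

theorem deletion (h : IsShiftedFamily m n 𝒜) : IsShiftedFamily (m + 1) n (deletion 𝒜 m) where
  subset_Icc F hF v hv := by
    have h1 := h.subset_Icc _ (mem_deletion.1 hF).1 hv
    have h2 : v ≠ m := fun e => (mem_deletion.1 hF).2 (e ▸ hv)
    simp only [mem_Icc] at h1 ⊢
    omega
  insert_erase_mem i hi j hj hij F hF hiF hjF := by
    simp only [mem_Icc] at hi hj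
    obtain ⟨hF, hm⟩ := mem_deletion.1 hF
    refine mem_deletion.2 ⟨h.insert_erase_mem i (mem_Icc.2 (by omega)) j (mem_Icc.2 (by omega))
      hij F hF hiF hjF, ?_⟩
    simp only [mem_insert, mem_erase, not_or, not_and]
    exact ⟨by omega, fun _ => hm⟩

/-- Replacing `j` by `m` in a member that avoids `m` is an allowed shift, as `m` is the least
vertex. -/
theorem shadow_deletion_subset_link (h : IsShiftedFamily m n 𝒜) :
    (ShiftedLaplacian.deletion 𝒜 m).shadow ⊆ ShiftedLaplacian.link 𝒜 m := by
  intro G hG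
  obtain ⟨F, hF, j, hj, rfl⟩ := mem_shadow_iff.1 hG
  have hIcc := mem_Icc.1 (h.deletion.subset_Icc F hF hj)
  obtain ⟨hF, hm⟩ := mem_deletion.1 hF
  exact mem_link.2 ⟨fun h' => hm (mem_of_mem_erase h'),
    h.insert_erase_mem m (mem_Icc.2 (by omega)) j (mem_Icc.2 (by omega)) (by omega) F hF hm hj⟩

end IsShiftedFamily

theorem familyDeg_eq_card_link (𝒜 : Finset (Finset ℕ)) (m : ℕ) :
    familyDeg 𝒜 m = (link 𝒜 m).card := by
  rw [familyDeg, link, Finset.card_image_of_injOn]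
  intro F hF G hG h
  simp only [coe_filter, Set.mem_ofPred_eq] at hF hG
  rw [← insert_erase hF.2, ← insert_erase hG.2]
  exact congrArg (insert m) h

theorem familyDeg_eq_add {𝒜 : Finset (Finset ℕ)} {m t : ℕ} (ht : t ≠ m) :
    familyDeg 𝒜 t = familyDeg (link 𝒜 m) t + familyDeg (deletion 𝒜 m) t := by
  have hl : familyDeg (link 𝒜 m) t = ((𝒜.filter (t ∈ ·)).filter (m ∈ ·)).card := by
    refine Finset.card_bij (fun F _ => insert m F) ?_ ?_ ?_
    · intro F hF
      simp only [mem_filter, mem_link] at hF ⊢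
      exact ⟨⟨hF.1.2, mem_insert_of_mem hF.2⟩, mem_insert_self _ _⟩
    · intro F hF G hG h
      simp only [mem_filter, mem_link] at hF hG
      have := congrArg (fun s => Finset.erase s m) h
      simpa [erase_insert hF.1.1, erase_insert hG.1.1] using this
    · intro F hF
      simp only [mem_filter] at hF
      refine ⟨F.erase m, ?_, insert_erase hF.2⟩
      simp only [mem_filter, mem_link, insert_erase hF.2]
      exact ⟨⟨notMem_erase _ _, hF.1.1⟩, mem_erase.2 ⟨ht, hF.1.2⟩⟩
  have hd : familyDeg (deletion 𝒜 m) t = ((𝒜.filter (t ∈ ·)).filter (m ∉ ·)).card := by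
    rw [familyDeg, deletion, Finset.filter_comm]
  rw [hl, hd, Finset.card_filter_add_card_filter_not]
  rfl

variable {K : Type*} [Field K]

/-- **Weighted Duval–Reiner theorem** for the down-up Laplacian of a shifted family. -/
theorem charpoly_downUpMatrix (x : ℕ → K) (n : ℕ) (N : ℕ) (hx : ∀ j, 1 ≤ j → x j ≠ 0) :
    ∀ m, 1 ≤ m → n + 1 - m = N → ∀ 𝒜 : Finset (Finset ℕ), IsShiftedFamily m n 𝒜 →
      X ^ familyDeg 𝒜 m * (downUpMatrix x 𝒜).charpoly =
        X ^ 𝒜.card * ∏ t ∈ Icc m n,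
          (X - C (∑ j ∈ Icc m t, x j ^ 2)) ^ (familyDeg 𝒜 t - familyDeg 𝒜 (t + 1)) := by
  induction N with
  | zero =>
    intro m _ hN 𝒜 h
    -- No vertices remain, so the family is contained in `{∅}` and its matrix is zero.
    have hIcc : Icc m n = ∅ := Icc_eq_empty (by omega)
    have he : ∀ F ∈ 𝒜, F = ∅ := fun F hF => by
      have := h.subset_Icc F hF
      rwa [hIcc, subset_empty] at this
    have hdeg : familyDeg 𝒜 m = 0 := by
      rw [familyDeg, Finset.card_eq_zero, Finset.filter_eq_empty_iff]
      intro F hF; simp [he F hF]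
    have hD : downUpMatrix x 𝒜 = 0 := by
      ext F F'
      simp [downUpMatrix, boundaryCoeff, he F.1 F.2]
    rw [hdeg, hIcc, hD, Finset.prod_empty, Matrix.charpoly_zero, Fintype.card_coe]
    simp
  | succ N ih =>
    intro m hm hN 𝒜 h
    have hmn : m ≤ n := by omega
    have ihL := ih (m + 1) (by omega) (by omega) _ h.link
    have ihD := ih (m + 1) (by omega) (by omega) _ h.deletion
    set L := link 𝒜 m with hL
    set B := deletion 𝒜 m with hB
    have hsh : B.shadow ⊆ L := h.shadow_deletion_subset_link
    set P := boundaryMatrix x L B with hP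
    let Q := boundaryMatrix x L.shadow L
    have hQQ : Q.transpose * Q = downUpMatrix x L :=
      boundaryMatrix_transpose_mul_self x subset_rfl
    have hPP : P.transpose * P = downUpMatrix x B := boundaryMatrix_transpose_mul_self x hsh
    have hPQ : P.transpose * downUpMatrix x L = 0 := by
      rw [← hQQ, ← Matrix.mul_assoc, ← Matrix.transpose_mul, boundaryMatrix_mul_boundaryMatrix x hsh,
        Matrix.transpose_zero, Matrix.zero_mul]
    have hcard : 𝒜.card = L.card + B.card := by
      have := Fintype.card_congr (linkSumDeletionEquiv 𝒜 m)
      simpa using this.symm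
    set R := (P * P.transpose + downUpMatrix x L).charpoly with hR
    have h1 : X ^ L.card * (downUpMatrix x 𝒜).charpoly =
        X ^ 𝒜.card * R.comp (X - C (x m ^ 2)) := by
      have e : ((downUpMatrix x 𝒜).submatrix (linkSumDeletionEquiv 𝒜 m)
          (linkSumDeletionEquiv 𝒜 m)).charpoly = (downUpMatrix x 𝒜).charpoly :=
        Matrix.charpoly_reindex (linkSumDeletionEquiv 𝒜 m).symm (downUpMatrix x 𝒜)
      rw [← e, downUpMatrix_submatrix_linkSumDeletion x
        (fun F hF v hv => (mem_Icc.1 (h.subset_Icc F hF hv)).1) hsh, hcard]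
      have := charpoly_fromBlocks_cone (x m) (hx m hm) P _ hPQ
      rwa [charpoly_scalar_add, Fintype.card_coe, Fintype.card_coe] at this
    have h2 : R * X ^ L.card = (P * P.transpose).charpoly * (downUpMatrix x L).charpoly := by
      have := charpoly_add_mul_X_pow_of_mul_eq_zero (P * P.transpose) (downUpMatrix x L)
        (by rw [Matrix.mul_assoc, hPQ, Matrix.mul_zero])
      rwa [Fintype.card_coe] at this
    have h3 : X ^ B.card * (P * P.transpose).charpoly =
        X ^ L.card * (downUpMatrix x B).charpoly := by
      have := Matrix.charpoly_mul_comm' P P.transpose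
      rwa [hPP, Fintype.card_coe, Fintype.card_coe] at this
    have hdeg : ∀ t, m + 1 ≤ t → familyDeg 𝒜 t = familyDeg L t + familyDeg B t :=
      fun t ht => familyDeg_eq_add (by omega)
    have hLd : familyDeg 𝒜 m = L.card := familyDeg_eq_card_link 𝒜 m
    have hprod : ∀ f : ℕ → K[X], (∏ t ∈ Icc (m + 1) n, f t ^ (familyDeg L t - familyDeg L (t + 1))) *
        (∏ t ∈ Icc (m + 1) n, f t ^ (familyDeg B t - familyDeg B (t + 1))) =
        ∏ t ∈ Icc (m + 1) n, f t ^ (familyDeg 𝒜 t - familyDeg 𝒜 (t + 1)) := by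
      intro f
      rw [← Finset.prod_mul_distrib]
      refine Finset.prod_congr rfl fun t ht => ?_
      have ht := (mem_Icc.1 ht).1
      rw [← pow_add, hdeg t ht, hdeg (t + 1) (by omega)]
      have a1 := h.link.familyDeg_antitone ht t.le_succ
      have a2 := h.deletion.familyDeg_antitone ht t.le_succ
      congr 1
      simp only [← hL, ← hB, Nat.succ_eq_add_one] at a1 a2
      omega
    have hle : familyDeg 𝒜 (m + 1) ≤ L.card := hLd ▸ h.familyDeg_antitone le_rfl m.le_succ
    -- The power of `X` collects the leftover zero eigenvalues; after the shift by `x m ^ 2` it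
    -- becomes the factor for `t = m`, since `familyDeg 𝒜 m = L.card`.
    have h4 : R = X ^ (L.card - familyDeg 𝒜 (m + 1)) * ∏ t ∈ Icc (m + 1) n,
        (X - C (∑ j ∈ Icc (m + 1) t, x j ^ 2)) ^ (familyDeg 𝒜 t - familyDeg 𝒜 (t + 1)) := by
      have hX : (X : K[X]) ^ (L.card + B.card + familyDeg 𝒜 (m + 1)) ≠ 0 := pow_ne_zero _ X_ne_zero
      have hpow : (X : K[X]) ^ L.card =
          X ^ familyDeg 𝒜 (m + 1) * X ^ (L.card - familyDeg 𝒜 (m + 1)) := by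
        rw [← pow_add, Nat.add_sub_cancel' hle]
      apply mul_left_cancel₀ hX
      rw [← hprod]
      calc X ^ (L.card + B.card + familyDeg 𝒜 (m + 1)) * R
          = X ^ familyDeg L (m + 1) * X ^ familyDeg B (m + 1) * X ^ B.card *
              (R * X ^ L.card) := by rw [hdeg _ le_rfl]; ring
        _ = X ^ familyDeg L (m + 1) * X ^ familyDeg B (m + 1) *
              (X ^ B.card * (P * P.transpose).charpoly) * (downUpMatrix x L).charpoly := by
            rw [h2]; ring
        _ = X ^ L.card * (X ^ familyDeg L (m + 1) * (downUpMatrix x L).charpoly) *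
              (X ^ familyDeg B (m + 1) * (downUpMatrix x B).charpoly) := by
            rw [h3]; ring
        _ = X ^ L.card * (X ^ L.card * X ^ B.card) *
            ((∏ t ∈ Icc (m + 1) n, (X - C (∑ j ∈ Icc (m + 1) t, x j ^ 2)) ^
              (familyDeg L t - familyDeg L (t + 1))) *
            (∏ t ∈ Icc (m + 1) n, (X - C (∑ j ∈ Icc (m + 1) t, x j ^ 2)) ^
              (familyDeg B t - familyDeg B (t + 1)))) := by
            rw [ihL, ihD]; ring
        _ = _ := by
            nth_rewrite 1 [hpow]; ring
    rw [hLd, h1, h4, ← Finset.insert_Icc_add_one_left_eq_Icc hmn, Finset.prod_insert (by simp)]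
    congr 1
    rw [hLd, Polynomial.mul_comp, Polynomial.prod_comp]
    congr 1
    · simp
    · refine Finset.prod_congr rfl fun t ht => ?_
      rw [← Finset.insert_Icc_add_one_left_eq_Icc (show m ≤ t by
        have := (mem_Icc.1 ht).1; omega), Finset.sum_insert (by simp)]
      simp only [pow_comp, sub_comp, X_comp, C_comp, map_add]
      congr 1
      ring

end Shifted

/-! ### From characteristic polynomials to eigenvalues of the complex -/

section Eigenvalues

variable {K : Type*} [Field K]

/-- Powers of `X` contribute only the root zero, which the filter discards. -/
theorem hasEigenvaluesUpToZero_of_charpoly {ι : Type*} [Fintype ι] [DecidableEq ι]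
    {M : Matrix ι ι K} {A : Multiset K} {a b : ℕ}
    (h : X ^ a * M.charpoly = X ^ b * (A.map fun e => X - C e).prod) :
    HasEigenvaluesUpToZero M A := by
  classical
  have hA : (A.map fun e => X - C e).prod ≠ 0 := (monic_multisetProd_X_sub_C A).ne_zero
  have hM : M.charpoly ≠ 0 := M.charpoly_monic.ne_zero
  have hX : ∀ c : ℕ, (X : K[X]) ^ c ≠ 0 := fun c => pow_ne_zero _ X_ne_zero
  constructor
  · refine Splits.of_dvd (g := X ^ b * (A.map fun e => X - C e).prod) ?_
      (mul_ne_zero (hX b) hA) (h ▸ dvd_mul_left _ _)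
    refine (Splits.X.pow b).mul (Splits.multisetProd fun f hf => ?_)
    obtain ⟨e, _, rfl⟩ := Multiset.mem_map.1 hf
    exact Splits.X_sub_C e
  · have hr := congrArg Polynomial.roots h
    rw [roots_mul (mul_ne_zero (hX a) hM), roots_mul (mul_ne_zero (hX b) hA),
      roots_multiset_prod_X_sub_C, roots_pow, roots_pow, roots_X] at hr
    have hf := congrArg (Multiset.filter (· ≠ 0)) hr
    have hz : ∀ c : ℕ, Multiset.filter (· ≠ (0 : K)) (c • {0}) = 0 := fun c => by
      rw [Multiset.filter_nsmul]; simp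
    rw [Multiset.filter_add, Multiset.filter_add, hz, hz, zero_add, zero_add] at hf
    convert hf

/-- Raising has no effect on weights that ignore the position, and `x_F / x_{F∖j}` reduces to `x_j`
for nonzero weights. -/
theorem boundary_eq_boundaryMatrix {w : ℕ → K} (hw : ∀ j, w j ≠ 0) {V : Finset ℕ}
    (S : Complex V) (d : ℕ) :
    boundary (fun _ j => w j) S d d =
      boundaryMatrix w (S.facesOfCard d) (S.facesOfCard (d + 1)) := by
  ext G F
  simp only [boundary, boundaryMatrix, boundaryCoeff, raisedMonomial, Matrix.of_apply]
  refine Finset.sum_congr rfl fun j hj => ?_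
  rw [← Finset.mul_prod_erase F.1 w hj,
    mul_div_cancel_right₀ _ (Finset.prod_ne_zero_iff.2 fun v _ => hw v)]

theorem Complex.shadow_facesOfCard_subset {V : Finset ℕ} (S : Complex V) (d : ℕ) :
    (S.facesOfCard (d + 1)).shadow ⊆ S.facesOfCard d := by
  intro G hG
  obtain ⟨F, hF, j, hj, rfl⟩ := mem_shadow_iff.1 hG
  simp only [Complex.facesOfCard, mem_filter] at hF ⊢
  exact ⟨S.down_closed F hF.1 _ (erase_subset _ _), by rw [card_erase_of_mem hj, hF.2]; rfl⟩

theorem Complex.IsShifted.facesOfCard {n : ℕ} {S : Complex (Icc 1 n)} (h : S.IsShifted) (c : ℕ) :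
    IsShiftedFamily 1 n (S.facesOfCard c) where
  subset_Icc F hF := S.subset_vertices F (mem_filter.1 hF).1
  insert_erase_mem i hi j hj hij F hF hiF hjF := by
    simp only [Complex.facesOfCard, mem_filter] at hF ⊢
    refine ⟨h i hi j hj hij F hF.1 hiF hjF, ?_⟩
    rw [card_insert_of_notMem fun h' => hiF (mem_of_mem_erase h'), card_erase_add_one hjF, hF.2]

theorem hasEigenvaluesUpToZero_upDownLaplacian {w : ℕ → K} (hw : ∀ j, w j ≠ 0) {n : ℕ}
    {S : Complex (Icc 1 n)} (hS : S.IsShifted) (d : ℕ) :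
    HasEigenvaluesUpToZero (upDownLaplacian (fun _ j => w j) S d d)
      ((conjugateParts n (S.deg d)).map fun t => ∑ j ∈ Icc 1 t, w j ^ 2) := by
  have h1 := charpoly_downUpMatrix w n _ (fun j _ => hw j) 1 le_rfl rfl _
    (hS.facesOfCard (d + 1))
  -- Passage from `∂∂ᵀ` to `∂ᵀ∂`.
  have h2 := Matrix.charpoly_mul_comm' (boundary (fun _ j => w j) S d d)
    (boundary (fun _ j => w j) S d d).transpose
  rw [← upDownLaplacian, boundary_eq_boundaryMatrix hw,
    boundaryMatrix_transpose_mul_self w (S.shadow_facesOfCard_subset d)] at h2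
  refine hasEigenvaluesUpToZero_of_charpoly
    (a := familyDeg (S.facesOfCard (d + 1)) 1 + Fintype.card (S.facesOfCard (d + 1)))
    (b := Fintype.card (S.facesOfCard d) + (S.facesOfCard (d + 1)).card) ?_
  have h3 : ((((conjugateParts n (S.deg d)).map fun t => ∑ j ∈ Icc 1 t, w j ^ 2).map
      fun e => X - C e).prod : K[X]) = ∏ t ∈ Icc 1 n, (X - C (∑ j ∈ Icc 1 t, w j ^ 2)) ^
        (familyDeg (S.facesOfCard (d + 1)) t - familyDeg (S.facesOfCard (d + 1)) (t + 1)) := by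
    rw [conjugateParts, Multiset.map_map, ← Multiset.coe_mapAddMonoidHom, map_sum,
      Multiset.prod_sum]
    refine Finset.prod_congr rfl fun t _ => ?_
    rw [Multiset.coe_mapAddMonoidHom, Multiset.map_replicate, Multiset.prod_replicate]
    rfl
  rw [h3, pow_add, mul_assoc, h2, mul_left_comm, h1, pow_add, mul_assoc]

theorem coarseVar_ne_zero (k : Type*) [Field k] (j : ℕ) : coarseVar k j ≠ 0 := by
  rw [coarseVar, Ne, IsFractionRing.to_map_eq_zero_iff]
  exact MvPolynomial.X_ne_zero j

end Eigenvalues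

end ShiftedLaplacian

open ShiftedLaplacian in
theorem corollary7p9 {k : Type*} [Field k] [CharZero k] (n d : ℕ)
    (S : ShiftedLaplacian.Complex (Finset.Icc 1 n)) (hdim : S.HasDim d) (hS : S.IsShifted) :
    (∀ v w : ℕ, 1 ≤ v → v ≤ w → S.deg d w ≤ S.deg d v) ∧
    HasEigenvaluesUpToZero (coarseLaplacian k S d d)
      ((conjugateParts n (S.deg d)).map (linearForm k)) ∧
    HasEigenvaluesUpToZero (unweightedLaplacian k S d d)
      ((conjugateParts n (S.deg d)).map (fun t : ℕ => (t : k))) := by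
  refine ⟨fun v w hv hvw => (hS.facesOfCard (d + 1)).familyDeg_antitone hv hvw,
    hasEigenvaluesUpToZero_upDownLaplacian (coarseVar_ne_zero k) hS d, ?_⟩
  -- With unit weights, `E_t` becomes a sum of `t` ones.
  have h := hasEigenvaluesUpToZero_upDownLaplacian (K := k) (w := fun _ => 1)
    (fun _ => one_ne_zero) hS d
  simpa [unweightedLaplacian] using h
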